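/- Let $N\in\mathbb N$, let $G$ be a directed graph on $\{1,\dots,N\}$ with adjacency matrix $(a_{ij})\in\{0,1\}^{N\times N}$ ($a_{ij}=1$ iff $(i,j)$ is an arc), and let $w_i=\sum_{j=1}^N a_{ij}$ be the out-degree of node $i$. Let $T>0$, $\beta>0$, $a_1,\dots,a_N\ge 0$, $0<\underline{x}\le\overline{x}$, $0<\underline{y}\le\overline{y}$, and $\mathbf C_0\in[0,1]^N$. Let $$\mathscr U=\{\mathbf u=(x_1,\dots,x_N,y_1,\dots,y_N)\in (L^2[0,T])^{2N} : \underline{x}\le x_i(t)\le\overline{x},\ \underline{y}\le y_i(t)\le\overline{y}\text{ for a.e. }t\in[0,T],\ 1\le i\le N\}.$$ A state for $\mathbf u\in\mathscr U$ is an absolutely continuous $\mathbf C=(C_1,\dots,C_N):[0,T]\to\mathbb R^N$ with $\mathbf C(0)=\mathbf C_0$ and, for a.e. $t\in[0,T]$ and all $i$, $$\frac{dC_i(t)}{dt}=\frac{1}{x_i(t)}\Big[a_i+\beta\sum_{j=1}^N a_{ji}C_j(t)\Big]\big[1-C_i(t)\big]-y_i(t)C_i(t).$$ Then the problem of minimizing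 (expected loss plus defense cost) $$J(\mathbf u,\mathbf C)=\int_0^T\sum_{i=1}^N\big[w_iC_i(t)+x_i(t)+y_i(t)\big]\,dt$$ over all $\mathbf u\in\mathscr U$ and states $\mathbf C$ for $\mathbf u$ has an optimal control: there are $\mathbf u^*\in\mathscr U$ and a state $\mathbf C^*$ for $\mathbf u^*$ such that $J(\mathbf u^*,\mathbf C^*)\le J(\mathbf u,\mathbf C)$ for every $\mathbf u\in\mathscr U$ and every state $\mathbf C$ for $\mathbf u$. -/

import Mathlib

open MeasureTheory

noncomputable section

namespace APT

/-- The data of the attack-defense control problem on `N` systems: the (directed) access network,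
the time horizon, the infection force, the attack strategy, the bounds on the prevention and
recovery costs per unit time, and the initial expected state. -/
structure Problem (N : ℕ) where
  /-- `G.Adj i j` means that system `i` has access to system `j`. -/
  G : Digraph (Fin N)
  T : ℝ
  β : ℝ
  a : Fin N → ℝ
  xLow : ℝ
  xHigh : ℝ
  yLow : ℝ
  yHigh : ℝ
  C₀ : Fin N → ℝ

namespace Problem

variable {N : ℕ} (P : Problem N)

open Classical in
/-- Entry `(i, j)` of the adjacency matrix of the access network. -/
def adj (i j : Fin N) : ℝ := if P.G.Adj i j then 1 else 0

/-- The out-degree of node `i`. -/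
def w (i : Fin N) : ℝ := ∑ j, P.adj i j

/-- The right-hand side `F(C, (x, y))` of the attack-defense model. -/
def F (C x y : Fin N → ℝ) (i : Fin N) : ℝ :=
  1 / x i * (P.a i + P.β * ∑ j, P.adj j i * C j) * (1 - C i) - y i * C i

/-- The running cost `L(C, (x, y))`. -/
def L (C x y : Fin N → ℝ) : ℝ := ∑ i, (P.w i * C i + x i + y i)

/-- `(L²[0,T])^{2N}`: a defense strategy `u = (x, y)`, with `x = u.1` and `y = u.2`. -/
abbrev Control : Type :=
  (Fin N → Lp ℝ 2 (volume.restrict (Set.Icc (0 : ℝ) P.T))) ×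
    (Fin N → Lp ℝ 2 (volume.restrict (Set.Icc (0 : ℝ) P.T)))

variable {P} in
/-- The prevention strategy at time `t`. -/
def Control.x (u : P.Control) (t : ℝ) : Fin N → ℝ := fun i => u.1 i t

variable {P} in
/-- The recovery strategy at time `t`. -/
def Control.y (u : P.Control) (t : ℝ) : Fin N → ℝ := fun i => u.2 i t

/-- The admissible set. Elements of `L²` are classes modulo null sets, so the bounds are required
for almost every `t ∈ [0,T]`. -/
def admissible : Set P.Control :=
  {u | ∀ᵐ t ∂volume.restrict (Set.Icc (0 : ℝ) P.T), ∀ i,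
    (P.xLow ≤ Control.x u t i ∧ Control.x u t i ≤ P.xHigh) ∧
      (P.yLow ≤ Control.y u t i ∧ Control.y u t i ≤ P.yHigh)}

/-- `C` is a (Carathéodory) solution on `[0,T]` of `dC/dt = F(C, u)`, `C(0) = C₀`: it is absolutely
continuous on `[0,T]` and satisfies the equation at almost every `t ∈ [0,T]`. -/
structure IsState (u : P.Control) (C : ℝ → Fin N → ℝ) : Prop where
  absolutelyContinuous : AbsolutelyContinuousOnInterval C 0 P.T
  hasDerivAt : ∀ᵐ t ∂volume.restrict (Set.Icc (0 : ℝ) P.T),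
    HasDerivAt C (P.F (C t) (Control.x u t) (Control.y u t)) t
  initial : C 0 = P.C₀

/-- The objective `∫₀ᵀ L(C(t), u(t)) dt`. -/
def J (u : P.Control) (C : ℝ → Fin N → ℝ) : ℝ :=
  ∫ t in (0 : ℝ)..P.T, P.L (C t) (Control.x u t) (Control.y u t)

/-- `u` is an optimal control: it is admissible, the state equation is solvable for `u`, and the
resulting value of the objective is at most the value for every admissible control and state. -/
def IsOptimalControl (u : P.Control) : Prop :=
  u ∈ P.admissible ∧ ∃ C, P.IsState u C ∧
    ∀ v ∈ P.admissible, ∀ D, P.IsState v D → P.J u C ≤ P.J v D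

end Problem

end APT

end

/-!
The running cost is linear in the state and in `y`, and the dynamics is affine in `z = 1 / x` and
`y`, while the cost of prevention `x = 1 / z` is convex in `z`. The existence of an optimal control
is therefore a matter of compactness and lower semicontinuity. The compactness used here is
Tychonoff's theorem, applied to primitives instead of controls: a control with a state `C` is
recorded by `C` together with the primitives `Z` of `1 / x`, `Y` of `y` and `Q` of the running cost.

All these functions are Lipschitz with constants independent of the control, because the unit cube
is invariant under the state equation (`IsState.mem_Icc`, a Gronwall argument for the negative parts
in `nonneg_of_ae_hasDerivAt`). Freezing the state at the left end of an interval `[s, t]` turns the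
state equation into an inequality between increments with error `K * (t - s) ^ 2`, and the running
cost into a lower bound for the increments of `Q`, where `1 / z` is replaced by its tangents. These
inequalities, collected in `IsRelaxed`, involve finitely many values of the functions at a time, so
they define a compact set for pointwise convergence (`isCompact_isRelaxed`), on which `Q T` attains
its minimum. The set is nonempty because a constant control has a state (`exists_state`).

Conversely, at almost every time the inequalities can be differentiated: a relaxed trajectory solves
the state equation for the controls `1 / Z'` and `Y'`, and `Q'` dominates the running cost, by the
tangent at `Z'` (`IsRelaxed.exists_control`). The minimizer thus yields an optimal control. The
errors `K * (t - s) ^ 2` disappear in the derivative, and no convergence of integrals is needed.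
-/

open MeasureTheory Set Filter Topology

/-! ### Absolutely continuous functions and one-sided derivative bounds -/

namespace AbsolutelyContinuousOnInterval

theorem lipschitz_comp {X Y : Type*} [PseudoMetricSpace X] [PseudoMetricSpace Y] {f : ℝ → X}
    {a b : ℝ} (hf : AbsolutelyContinuousOnInterval f a b) {φ : X → Y} {K : NNReal}
    (hφ : LipschitzWith K φ) : AbsolutelyContinuousOnInterval (fun t => φ (f t)) a b := by
  have h := Filter.Tendsto.const_mul (K : ℝ) hf
  rw [mul_zero] at h
  refine squeeze_zero (fun E => Finset.sum_nonneg fun _ _ => dist_nonneg) (fun E => ?_) h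
  rw [Finset.mul_sum]
  exact Finset.sum_le_sum fun i _ => hφ.dist_le_mul _ _

theorem apply {ι : Type*} [Fintype ι] {f : ℝ → ι → ℝ} {a b : ℝ}
    (hf : AbsolutelyContinuousOnInterval f a b) (i : ι) :
    AbsolutelyContinuousOnInterval (fun t => f t i) a b :=
  hf.lipschitz_comp (LipschitzWith.eval i)

theorem const {F : Type*} [SeminormedAddCommGroup F] (c : F) (a b : ℝ) :
    AbsolutelyContinuousOnInterval (fun _ => c) a b :=
  (LipschitzWith.const c).lipschitzOnWith.absolutelyContinuousOnInterval

theorem finset_sum {ι : Type*} {F : Type*} [SeminormedAddCommGroup F] (s : Finset ι)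
    {f : ι → ℝ → F} {a b : ℝ} (hf : ∀ i ∈ s, AbsolutelyContinuousOnInterval (f i) a b) :
    AbsolutelyContinuousOnInterval (fun t => ∑ i ∈ s, f i t) a b := by
  classical
  induction s using Finset.induction_on with
  | empty => simpa using const (0 : F) a b
  | insert i s hi ih =>
    simp only [Finset.sum_insert hi]
    exact (hf i (by simp)).fun_add (ih fun j hj => hf j (by simp [hj]))

/-- Mean value inequality: an almost everywhere bound on the derivative suffices for absolutely
continuous functions. -/
theorem sub_le_mul_of_ae_hasDerivAt {f : ℝ → ℝ} {a b K : ℝ} (hab : a ≤ b)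
    (hf : AbsolutelyContinuousOnInterval f a b)
    (hd : ∀ᵐ t, t ∈ Icc a b → ∃ d, HasDerivAt f d t ∧ d ≤ K) : f b - f a ≤ K * (b - a) := by
  rw [← hf.integral_deriv_eq_sub]
  have h : ∫ t in a..b, deriv f t ≤ ∫ _ in a..b, K := by
    refine intervalIntegral.integral_mono_ae_restrict hab hf.intervalIntegrable_deriv (by simp) ?_
    rw [EventuallyLE, ae_restrict_iff' measurableSet_Icc]
    filter_upwards [hd] with t ht hmem
    obtain ⟨d, hd, hle⟩ := ht hmem
    rwa [hd.deriv]
  simpa [mul_comm] using h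

theorem abs_sub_le_mul_of_ae_hasDerivAt {f : ℝ → ℝ} {a b K : ℝ} (hab : a ≤ b)
    (hf : AbsolutelyContinuousOnInterval f a b)
    (hd : ∀ᵐ t, t ∈ Icc a b → ∃ d, HasDerivAt f d t ∧ |d| ≤ K) :
    |f b - f a| ≤ K * (b - a) := by
  rw [abs_le]
  constructor
  · have := sub_le_mul_of_ae_hasDerivAt (K := K) hab hf.fun_neg (by
      filter_upwards [hd] with t ht hmem
      obtain ⟨d, hd, hle⟩ := ht hmem
      exact ⟨-d, hd.fun_neg, (neg_le_abs d).trans hle⟩)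
    linarith
  · exact sub_le_mul_of_ae_hasDerivAt hab hf (by
      filter_upwards [hd] with t ht hmem
      obtain ⟨d, hd, hle⟩ := ht hmem
      exact ⟨d, hd, (le_abs_self d).trans hle⟩)

end AbsolutelyContinuousOnInterval

theorem hasDerivAt_min_zero_sq (s : ℝ) :
    HasDerivAt (fun r : ℝ => min r 0 ^ 2) (2 * min s 0) s := by
  rcases lt_trichotomy s 0 with hs | rfl | hs
  · have h : (fun r : ℝ => min r 0 ^ 2) =ᶠ[𝓝 s] fun r => r ^ 2 := by
      filter_upwards [Iio_mem_nhds hs] with r hr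
      rw [min_eq_left (le_of_lt hr)]
    rw [min_eq_left hs.le]
    simpa using (hasDerivAt_pow 2 s).congr_of_eventuallyEq h
  · rw [hasDerivAt_iff_isLittleO_nhds_zero]
    have h : (fun r : ℝ => r ^ 2) =o[𝓝 0] fun r : ℝ => r := by
      simpa using Asymptotics.isLittleO_pow_id (𝕜 := ℝ) (n := 2) (by norm_num)
    refine (Asymptotics.IsBigO.of_bound 1 (Eventually.of_forall fun r => ?_)).trans_isLittleO h
    rcases le_total r 0 with hr | hr <;> simp [hr]
  · have h : (fun r : ℝ => min r 0 ^ 2) =ᶠ[𝓝 s] fun _ => 0 := by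
      filter_upwards [Ioi_mem_nhds hs] with r hr
      rw [min_eq_right (le_of_lt hr)]; simp
    rw [min_eq_right hs.le]
    simpa using (hasDerivAt_const s (0 : ℝ)).congr_of_eventuallyEq h

/-- Invariance of the nonnegative orthant: if, wherever a component is negative, its derivative is
at least a multiple of the sum of the negative parts, then the components stay nonnegative. This is
Gronwall's inequality for `∑ i, (min (g i) 0) ^ 2`. -/
theorem nonneg_of_ae_hasDerivAt {ι : Type*} [Fintype ι] {g : ℝ → ι → ℝ} {T K : ℝ} (hK : 0 ≤ K)
    (hg : AbsolutelyContinuousOnInterval g 0 T) (h0 : ∀ i, 0 ≤ g 0 i)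
    (hd : ∀ᵐ t, t ∈ Icc 0 T → ∀ i, ∃ d, HasDerivAt (fun r => g r i) d t ∧
      (g t i < 0 → K * ∑ j, min (g t j) 0 ≤ d)) :
    ∀ t ∈ Icc 0 T, ∀ i, 0 ≤ g t i := by
  intro t ht i
  set c : ℝ := 2 * K * Fintype.card ι with hc
  let V : ℝ → ℝ := fun r => Real.exp (-c * r) * ∑ j, min (g r j) 0 ^ 2
  have hsub : uIcc 0 t ⊆ uIcc 0 T := by
    rw [uIcc_of_le ht.1, uIcc_of_le (ht.1.trans ht.2)]
    exact Icc_subset_Icc_right ht.2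
  have hmin (j : ι) : AbsolutelyContinuousOnInterval (fun r => min (g r j) 0) 0 t :=
    ((hg.mono hsub).apply j).lipschitz_comp (LipschitzWith.id.min_const 0)
  -- The exponential weight makes `V` nonincreasing, and `V 0 = 0`.
  have hV : AbsolutelyContinuousOnInterval V 0 t := by
    refine AbsolutelyContinuousOnInterval.fun_mul
      (ContDiffOn.absolutelyContinuousOnInterval (by fun_prop)) ?_
    refine AbsolutelyContinuousOnInterval.finset_sum _ fun j _ => ?_
    simp only [pow_two]
    exact (hmin j).fun_mul (hmin j)
  have hle : V t - V 0 ≤ 0 * (t - 0) := by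
    refine hV.sub_le_mul_of_ae_hasDerivAt ht.1 ?_
    filter_upwards [hd] with r hr hrt
    choose d hd hdle using hr ⟨hrt.1, hrt.2.trans ht.2⟩
    have hs : HasDerivAt (fun r => ∑ j, min (g r j) 0 ^ 2) (∑ j, 2 * min (g r j) 0 * d j) r :=
      HasDerivAt.fun_sum fun j _ => 
        HasDerivAt.comp (h₂ := fun r : ℝ => min r 0 ^ 2) r (hasDerivAt_min_zero_sq (g r j)) (hd j)
    have he : HasDerivAt (fun r => Real.exp (-c * r)) (Real.exp (-c * r) * (-c)) r := by
      simpa using ((hasDerivAt_id r).const_mul (-c)).exp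
    refine ⟨_, he.mul hs, ?_⟩
    have h1 : ∑ j, 2 * min (g r j) 0 * d j ≤ ∑ j, 2 * min (g r j) 0 * (K * ∑ k, min (g r k) 0) := by
      refine Finset.sum_le_sum fun j _ => ?_
      rcases lt_or_ge (g r j) 0 with hj | hj
      · exact mul_le_mul_of_nonpos_left (hdle j hj) (by rw [min_eq_left hj.le]; linarith)
      · simp [min_eq_right hj]
    have h2 : ∑ j, 2 * min (g r j) 0 * (K * ∑ k, min (g r k) 0)
        = 2 * K * (∑ k, min (g r k) 0) ^ 2 := by
      rw [← Finset.sum_mul, ← Finset.mul_sum]; ring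
    have h3 : (∑ k, min (g r k) 0) ^ 2 ≤ Fintype.card ι * ∑ k, min (g r k) 0 ^ 2 :=
      sq_sum_le_card_mul_sum_sq
    have h4 : ∑ j, 2 * min (g r j) 0 * d j ≤ c * ∑ k, min (g r k) 0 ^ 2 := by
      rw [h2] at h1
      refine h1.trans ?_
      have := mul_le_mul_of_nonneg_left h3 hK
      rw [hc]
      linarith
    have := mul_le_mul_of_nonneg_left h4 (Real.exp_pos (-c * r)).le
    linarith
  have hV0 : V 0 = 0 := by simp [V, min_eq_right (h0 _)]
  have hsum : ∑ j, min (g t j) 0 ^ 2 ≤ 0 := by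
    by_contra! hpos
    have := mul_pos (Real.exp_pos (-c * t)) hpos
    simp only [V] at hle hV0
    linarith
  have hi : min (g t i) 0 ^ 2 ≤ 0 :=
    (Finset.single_le_sum (f := fun j => min (g t j) 0 ^ 2) (fun j _ => sq_nonneg _)
      (Finset.mem_univ i)).trans hsum
  have := pow_eq_zero_iff (two_ne_zero) |>.1 (le_antisymm hi (sq_nonneg _))
  exact min_eq_right_iff.1 this


/-- A lower bound on increments to the right, up to an error of second order, bounds the
derivative. -/
theorem le_of_hasDerivAt_of_sub_sq_le {f : ℝ → ℝ} {d m K s b : ℝ} (hsb : s < b)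
    (hf : HasDerivAt f d s)
    (hle : ∀ t ∈ Ioo s b, m * (t - s) - K * (t - s) ^ 2 ≤ f t - f s) : m ≤ d := by
  have h1 : Tendsto (slope f s) (𝓝[>] s) (𝓝 d) :=
    (hasDerivWithinAt_iff_tendsto_slope' (by simp)).1 hf.hasDerivWithinAt
  have h2 : Tendsto (fun t => m - K * (t - s)) (𝓝[>] s) (𝓝 m) := by
    have : Tendsto (fun t => m - K * (t - s)) (𝓝 s) (𝓝 (m - K * (s - s))) :=
      Continuous.tendsto (by fun_prop) s
    rw [sub_self, mul_zero, sub_zero] at this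
    exact this.mono_left nhdsWithin_le_nhds
  refine le_of_tendsto_of_tendsto h2 h1 ?_
  filter_upwards [Ioo_mem_nhdsGT hsb] with t ht
  have hpos : 0 < t - s := sub_pos.2 ht.1
  rw [slope_def_field, le_div_iff₀ hpos]
  have := hle t ht
  linarith

theorem ae_mem_Icc_imp_mem_Ioo (a b : ℝ) : ∀ᵐ t : ℝ, t ∈ Icc a b → t ∈ Ioo a b := by
  have ha : ∀ᵐ t : ℝ, t ≠ a := by simp [ae_iff, measure_singleton]
  have hb : ∀ᵐ t : ℝ, t ≠ b := by simp [ae_iff, measure_singleton]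
  filter_upwards [ha, hb] with t hta htb ht
  exact ⟨lt_of_le_of_ne ht.1 hta.symm, lt_of_le_of_ne ht.2 htb⟩

/-! ### Integral curves and primitives -/

/-- A bounded Lipschitz vector field has integral curves on every compact interval. -/
theorem exists_integralCurve_of_lipschitz_of_bounded {E : Type*} [NormedAddCommGroup E]
    [NormedSpace ℝ E] [CompleteSpace E] {v : E → E} {K M : NNReal} (hv : LipschitzWith K v)
    (hM : ∀ x, ‖v x‖ ≤ M) {T : ℝ} (hT : 0 ≤ T) (x₀ : E) :
    ∃ α : ℝ → E, α 0 = x₀ ∧ LipschitzOnWith M α (Icc 0 T) ∧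
      ∀ t ∈ Ioo 0 T, HasDerivAt α (v (α t)) t := by
  have hpl : IsPicardLindelof (fun _ => v) (⟨0, left_mem_Icc.2 hT⟩ : Icc 0 T) x₀
      (M * T.toNNReal) 0 M K :=
    { lipschitzOnWith := fun _ _ => hv.lipschitzOnWith
      continuousOn := fun _ _ => continuousOn_const
      norm_le := fun _ _ x _ => hM x
      mul_max_le := by simp [hT] }
  obtain ⟨α, hα0, hα⟩ := hpl.exists_eq_forall_mem_Icc_hasDerivWithinAt₀
  refine ⟨α, hα0, ?_, fun t ht => (hα t (Ioo_subset_Icc_self ht)).hasDerivAt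
    (Icc_mem_nhds ht.1 ht.2)⟩
  exact (convex_Icc 0 T).lipschitzOnWith_of_nnnorm_hasDerivWithin_le hα fun t _ => hM _

/-- The primitive of an interval integrable function, as an absolutely continuous function with
prescribed derivative almost everywhere. -/
theorem IntervalIntegrable.exists_primitive {f : ℝ → ℝ} {a b : ℝ} (hab : a ≤ b)
    (hf : IntervalIntegrable f volume a b) :
    ∃ g : ℝ → ℝ, g a = 0 ∧ g b = ∫ t in a..b, f t ∧ AbsolutelyContinuousOnInterval g a b ∧
      ∀ᵐ t, t ∈ Icc a b → HasDerivAt g (f t) t := by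
  refine ⟨fun t => ∫ r in a..t, f r, by simp, rfl,
    hf.absolutelyContinuousOnInterval_intervalIntegral left_mem_uIcc, ?_⟩
  filter_upwards [hf.ae_hasDerivAt_integral] with t ht hmem
  rw [uIcc_of_le hab] at ht
  exact ht hmem a (left_mem_Icc.2 hab)

/-! ### The state equation: invariance of the unit cube and solvability -/

namespace APT.Problem

variable {N : ℕ} (P : Problem N)

theorem adj_nonneg (i j : Fin N) : 0 ≤ P.adj i j := by
  unfold adj; split_ifs <;> norm_num

theorem adj_le_one (i j : Fin N) : P.adj i j ≤ 1 := by
  unfold adj; split_ifs <;> norm_num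

theorem w_nonneg (i : Fin N) : 0 ≤ P.w i := Finset.sum_nonneg fun _ _ => P.adj_nonneg _ _

/-- The infection rate of system `i` at unit prevention cost. The state equation reads
`Cᵢ' = xᵢ⁻¹ * infection C i - yᵢ * Cᵢ`. -/
noncomputable def infection (C : Fin N → ℝ) (i : Fin N) : ℝ :=
  (P.a i + P.β * ∑ j, P.adj j i * C j) * (1 - C i)

theorem F_eq (C x y : Fin N → ℝ) (i : Fin N) :
    P.F C x y i = (x i)⁻¹ * P.infection C i - y i * C i := by
  simp only [F, infection]; ring

theorem contDiff_infection : ContDiff ℝ 1 P.infection := by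
  unfold infection; fun_prop

theorem exists_lipschitzOnWith_infection :
    ∃ K : NNReal, LipschitzOnWith K P.infection (Icc 0 1) :=
  P.contDiff_infection.contDiffOn.exists_lipschitzOnWith (by decide) (convex_Icc _ _)
    isCompact_Icc

theorem exists_norm_infection_le :
    ∃ M : NNReal, ∀ c ∈ Icc (0 : Fin N → ℝ) 1, ‖P.infection c‖ ≤ M := by
  obtain ⟨M, hM⟩ := (isCompact_Icc (a := (0 : Fin N → ℝ)) (b := 1)).exists_bound_of_continuousOn
    P.contDiff_infection.continuous.continuousOn
  exact ⟨M.toNNReal, fun c hc => (hM c hc).trans (Real.le_coe_toNNReal M)⟩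

variable {P}

theorem IsState.ae_hasDerivAt {u : P.Control} {C : ℝ → Fin N → ℝ} (hC : P.IsState u C) :
    ∀ᵐ t, t ∈ Icc 0 P.T → ∀ i, HasDerivAt (fun r => C r i)
      ((u.x t i)⁻¹ * P.infection (C t) i - u.y t i * C t i) t := by
  filter_upwards [(ae_restrict_iff' measurableSet_Icc).1 hC.hasDerivAt] with t ht hmem i
  rw [← F_eq]
  exact hasDerivAt_pi.1 (ht hmem) i

theorem ae_of_mem_admissible {u : P.Control} (hu : u ∈ P.admissible) :
    ∀ᵐ t, t ∈ Icc 0 P.T → ∀ i, (P.xLow ≤ u.x t i ∧ u.x t i ≤ P.xHigh) ∧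
      (P.yLow ≤ u.y t i ∧ u.y t i ≤ P.yHigh) :=
  (ae_restrict_iff' measurableSet_Icc).1 hu

theorem infection_force_nonneg (hβ : 0 < P.β) (ha : ∀ i, 0 ≤ P.a i) {c : Fin N → ℝ} (hc : 0 ≤ c)
    (i : Fin N) : 0 ≤ P.a i + P.β * ∑ j, P.adj j i * c j :=
  add_nonneg (ha i) (mul_nonneg hβ.le
    (Finset.sum_nonneg fun j _ => mul_nonneg (P.adj_nonneg j i) (hc j)))

/-- The unit cube is invariant under the state equation. -/
theorem IsState.mem_Icc (hβ : 0 < P.β) (ha : ∀ i, 0 ≤ P.a i) (hx : 0 < P.xLow) (hy : 0 < P.yLow)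
    (hT : 0 < P.T) (hC₀ : ∀ i, 0 ≤ P.C₀ i ∧ P.C₀ i ≤ 1) {u : P.Control} (hu : u ∈ P.admissible)
    {C : ℝ → Fin N → ℝ} (hC : P.IsState u C) : ∀ t ∈ Icc 0 P.T, C t ∈ Icc 0 1 := by
  obtain ⟨B, hB⟩ := hC.absolutelyContinuous.exists_bound
  rw [uIcc_of_le hT.le] at hB
  have hB0 : 0 ≤ B := (norm_nonneg _).trans (hB 0 (left_mem_Icc.2 hT.le))
  have hz : 0 < P.xLow⁻¹ := inv_pos.2 hx
  -- Where `C i < 0`, the infection from the other systems is bounded below by their negative parts.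
  have hlow : ∀ t ∈ Icc 0 P.T, ∀ i, 0 ≤ C t i := by
    refine nonneg_of_ae_hasDerivAt (K := P.xLow⁻¹ * (1 + B) * P.β) (by positivity)
      hC.absolutelyContinuous (fun i => by rw [hC.initial]; exact (hC₀ i).1) ?_
    filter_upwards [hC.ae_hasDerivAt, ae_of_mem_admissible hu] with t hd hadm ht i
    refine ⟨_, hd ht i, fun hneg => ?_⟩
    obtain ⟨⟨hx1, -⟩, ⟨hy1, -⟩⟩ := hadm ht i
    set S := ∑ j, min (C t j) 0 with hS
    have hS0 : S ≤ 0 := Finset.sum_nonpos fun j _ => min_le_right _ _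
    have hsum : S ≤ ∑ j, P.adj j i * C t j := by
      refine Finset.sum_le_sum fun j _ => ?_
      have h0 := P.adj_nonneg j i
      have h1 := P.adj_le_one j i
      rcases le_total (C t j) 0 with hj | hj
      · rw [min_eq_left hj]; nlinarith
      · rw [min_eq_right hj]; positivity
    have hCi : 1 - C t i ≤ 1 + B := by
      have := (abs_le.1 ((norm_le_pi_norm (C t) i).trans (hB t ht))).1
      linarith
    have hzx : (u.x t i)⁻¹ ≤ P.xLow⁻¹ := inv_anti₀ hx hx1
    have hzx0 : 0 < (u.x t i)⁻¹ := inv_pos.2 (hx.trans_le hx1)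
    have h1 : P.β * S ≤ P.a i + P.β * ∑ j, P.adj j i * C t j := by
      have := mul_le_mul_of_nonneg_left hsum hβ.le
      linarith [ha i]
    have h2 : (u.x t i)⁻¹ * (1 - C t i) * (P.β * S) ≤ (u.x t i)⁻¹ * P.infection (C t) i := by
      unfold infection
      have := mul_le_mul_of_nonneg_left h1
        (mul_nonneg hzx0.le (by linarith : 0 ≤ 1 - C t i))
      linarith
    have h3 : P.xLow⁻¹ * (1 + B) * (P.β * S) ≤ (u.x t i)⁻¹ * (1 - C t i) * (P.β * S) :=
      mul_le_mul_of_nonpos_right (mul_le_mul hzx hCi (by linarith) hz.le)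
        (mul_nonpos_of_nonneg_of_nonpos hβ.le hS0)
    have h4 : 0 ≤ -(u.y t i * C t i) := by nlinarith
    linarith
  have hup : ∀ t ∈ Icc 0 P.T, ∀ i, 0 ≤ 1 - C t i := by
    refine nonneg_of_ae_hasDerivAt (g := fun t i => 1 - C t i) le_rfl
      ((AbsolutelyContinuousOnInterval.const (1 : Fin N → ℝ) 0 P.T).sub hC.absolutelyContinuous)
      (fun i => by rw [hC.initial]; linarith [(hC₀ i).2]) ?_
    filter_upwards [hC.ae_hasDerivAt, ae_of_mem_admissible hu] with t hd hadm ht i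
    refine ⟨_, (hd ht i).const_sub 1, fun hneg => ?_⟩
    obtain ⟨⟨hx1, -⟩, ⟨hy1, -⟩⟩ := hadm ht i
    have hzx0 : 0 < (u.x t i)⁻¹ := inv_pos.2 (hx.trans_le hx1)
    have h1 : P.infection (C t) i ≤ 0 :=
      mul_nonpos_of_nonneg_of_nonpos (infection_force_nonneg hβ ha (hlow t ht) i) hneg.le
    have h2 : (u.x t i)⁻¹ * P.infection (C t) i ≤ 0 :=
      mul_nonpos_of_nonneg_of_nonpos hzx0.le h1
    have h3 : 0 ≤ u.y t i * C t i := mul_nonneg (hy.le.trans hy1) (hlow t ht i)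
    simp only [zero_mul]
    linarith
  exact fun t ht => ⟨hlow t ht, fun i => sub_nonneg.1 (hup t ht i)⟩

/-- The constant defense strategy `x = xLow`, `y = yLow` admits a state: the vector field, composed
with the projection onto the unit cube, is bounded and Lipschitz, and its integral curve stays in
the cube. -/
theorem exists_state (hβ : 0 < P.β) (ha : ∀ i, 0 ≤ P.a i) (hx : 0 < P.xLow)
    (hx' : P.xLow ≤ P.xHigh) (hy : 0 < P.yLow) (hy' : P.yLow ≤ P.yHigh)
    (hT : 0 < P.T) (hC₀ : ∀ i, 0 ≤ P.C₀ i ∧ P.C₀ i ≤ 1) :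
    ∃ u ∈ P.admissible, ∃ C, P.IsState u C := by
  let π : (Fin N → ℝ) → Fin N → ℝ := fun c i => max 0 (min 1 (c i))
  have hπ : LipschitzWith 1 π := LipschitzWith.of_dist_le_mul fun c c' =>
    (dist_pi_le_iff (by positivity)).2 fun i => ((((LipschitzWith.eval
      (α := fun _ : Fin N => ℝ) i).const_min 1).const_max 0).dist_le_mul c c')
  have hπ_mem (c : Fin N → ℝ) : π c ∈ Icc 0 1 :=
    ⟨fun i => le_max_left _ _, fun i => max_le zero_le_one (min_le_left _ _)⟩
  let v : (Fin N → ℝ) → Fin N → ℝ := fun c => P.xLow⁻¹ • P.infection (π c) - P.yLow • π c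
  obtain ⟨K, hK⟩ := P.exists_lipschitzOnWith_infection
  obtain ⟨M, hM⟩ := P.exists_norm_infection_le
  have hinf : LipschitzWith (K * 1) fun c => P.infection (π c) :=
    lipschitzOnWith_univ.1 (hK.comp hπ.lipschitzOnWith fun c _ => hπ_mem c)
  have hv : LipschitzWith _ v :=
    ((lipschitzWith_smul P.xLow⁻¹).comp hinf).sub ((lipschitzWith_smul P.yLow).comp hπ)
  have hvM (c : Fin N → ℝ) :
      ‖v c‖ ≤ (‖P.xLow⁻¹‖₊ * M + ‖P.yLow‖₊ * 1 : NNReal) := by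
    have hπ1 : ‖π c‖ ≤ 1 := (pi_norm_le_iff_of_nonneg zero_le_one).2 fun i => by
      rw [Real.norm_of_nonneg ((hπ_mem c).1 i)]; exact (hπ_mem c).2 i
    refine (norm_sub_le _ _).trans ?_
    rw [norm_smul, norm_smul]
    push_cast
    exact add_le_add (mul_le_mul_of_nonneg_left (hM _ (hπ_mem c)) (norm_nonneg _))
      (mul_le_mul_of_nonneg_left hπ1 (norm_nonneg _))
  obtain ⟨C, hC0, hClip, hC⟩ := exists_integralCurve_of_lipschitz_of_bounded hv hvM hT.le P.C₀
  have hac : AbsolutelyContinuousOnInterval C 0 P.T := by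
    rw [← uIcc_of_le hT.le] at hClip
    exact hClip.absolutelyContinuousOnInterval
  have hlow : ∀ t ∈ Icc 0 P.T, ∀ i, 0 ≤ C t i := by
    refine nonneg_of_ae_hasDerivAt le_rfl hac (fun i => by rw [hC0]; exact (hC₀ i).1) ?_
    filter_upwards [ae_mem_Icc_imp_mem_Ioo 0 P.T] with t hIoo ht i
    refine ⟨_, hasDerivAt_pi.1 (hC t (hIoo ht)) i, fun hneg => ?_⟩
    have h0 : π (C t) i = 0 := max_eq_left ((min_le_right _ _).trans hneg.le)
    have h1 := infection_force_nonneg hβ ha (hπ_mem (C t)).1 i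
    simp only [v, infection, Pi.sub_apply, Pi.smul_apply, smul_eq_mul, h0]
    have := mul_nonneg (inv_pos.2 hx).le h1
    linarith
  have hup : ∀ t ∈ Icc 0 P.T, ∀ i, 0 ≤ 1 - C t i := by
    refine nonneg_of_ae_hasDerivAt (g := fun t i => 1 - C t i) le_rfl
      ((AbsolutelyContinuousOnInterval.const (1 : Fin N → ℝ) 0 P.T).sub hac)
      (fun i => by rw [hC0]; linarith [(hC₀ i).2]) ?_
    filter_upwards [ae_mem_Icc_imp_mem_Ioo 0 P.T] with t hIoo ht i
    refine ⟨_, (hasDerivAt_pi.1 (hC t (hIoo ht)) i).const_sub 1, fun hneg => ?_⟩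
    have h1 : π (C t) i = 1 := by
      simp only [π]
      rw [min_eq_left (by linarith), max_eq_right zero_le_one]
    simp only [v, infection, Pi.sub_apply, Pi.smul_apply, smul_eq_mul, h1]
    linarith
  have hπC : ∀ t ∈ Icc 0 P.T, π (C t) = C t := fun t ht => funext fun i => by
    simp only [π]
    rw [min_eq_right (sub_nonneg.1 (hup t ht i)), max_eq_right (hlow t ht i)]
  let u : P.Control := (fun _ => (memLp_const P.xLow).toLp _, fun _ => (memLp_const P.yLow).toLp _)
  have hux : ∀ᵐ t ∂volume.restrict (Icc 0 P.T), u.x t = fun _ => P.xLow := by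
    filter_upwards [(memLp_const P.xLow).coeFn_toLp] with t ht
    exact funext fun _ => ht
  have huy : ∀ᵐ t ∂volume.restrict (Icc 0 P.T), u.y t = fun _ => P.yLow := by
    filter_upwards [(memLp_const P.yLow).coeFn_toLp] with t ht
    exact funext fun _ => ht
  refine ⟨u, ?_, C, hac, ?_, hC0⟩
  · filter_upwards [hux, huy] with t h1 h2 i
    simp [h1, h2, hx', hy']
  · filter_upwards [hux, huy, ae_restrict_mem measurableSet_Icc,
      ae_restrict_of_ae (ae_mem_Icc_imp_mem_Ioo 0 P.T)] with t h1 h2 ht hIoo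
    convert! hC t (hIoo ht) using 1
    funext i
    simp [F_eq, v, h1, h2, hπC t ht]

end APT.Problem

/-! ### Relaxed trajectories -/

namespace APT.Problem

variable {N : ℕ} {P : Problem N}

theorem intervalIntegrable_of_Lp (hT : 0 ≤ P.T) (f : Lp ℝ 2 (volume.restrict (Icc (0 : ℝ) P.T))) :
    IntervalIntegrable f volume 0 P.T := by
  rw [intervalIntegrable_iff_integrableOn_Icc_of_le hT]
  exact (Lp.memLp f).integrable (by norm_num)

theorem intervalIntegrable_L (hT : 0 ≤ P.T) (u : P.Control) {C : ℝ → Fin N → ℝ}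
    (hC : ∀ i, ContinuousOn (fun t => C t i) (uIcc 0 P.T)) :
    IntervalIntegrable (fun t => P.L (C t) (u.x t) (u.y t)) volume 0 P.T := by
  simp only [L]
  have h : (fun t => ∑ i, (P.w i * C t i + u.x t i + u.y t i))
      = ∑ i, fun t => (P.w i * C t i + u.x t i + u.y t i) := by
    funext t; simp
  rw [h]
  refine IntervalIntegrable.sum _ fun i _ => ?_
  exact (((hC i).intervalIntegrable.const_mul _).add (intervalIntegrable_of_Lp hT (u.1 i))).add
    (intervalIntegrable_of_Lp hT (u.2 i))

theorem intervalIntegrable_inv_x (hT : 0 ≤ P.T) (hx : 0 < P.xLow) {u : P.Control}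
    (hu : u ∈ P.admissible) (i : Fin N) :
    IntervalIntegrable (fun t => (u.x t i)⁻¹) volume 0 P.T := by
  rw [intervalIntegrable_iff_integrableOn_Icc_of_le hT]
  have hm : AEStronglyMeasurable (fun t => (u.x t i)⁻¹) (volume.restrict (Icc 0 P.T)) :=
    (Lp.aestronglyMeasurable (u.1 i)).aemeasurable.inv.aestronglyMeasurable
  refine Integrable.of_bound hm P.xLow⁻¹ ?_
  filter_upwards [hu] with t ht
  obtain ⟨⟨h1, -⟩, -⟩ := ht i
  rw [norm_inv, Real.norm_of_nonneg (hx.le.trans h1)]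
  exact inv_anti₀ hx h1

variable (P) in
/-- Relaxed trajectories. Here `Z`, `Y` and `Q` stand for the primitives of `1 / x`, of `y` and of
the running cost. Integrated over short intervals, the state equation, the bounds on the controls
and the definition of the cost become inequalities between increments of these functions, up to an
error of second order. The running cost enters as a lower bound on the increments of `Q` only, with
the convex function `z ↦ 1 / z` replaced by its tangents `z ↦ 2 * l - l ^ 2 * z`. All conditions
are therefore preserved by pointwise limits. The bounds are demanded at every real time, although
only times in `[0, T]` matter, to place the functions in a product of compact sets. -/
structure IsRelaxed (K : ℝ) (C Z Y : ℝ → Fin N → ℝ) (Q : ℝ → ℝ) : Prop where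
  C_mem : ∀ t, C t ∈ Icc 0 1
  Z_mem : ∀ t, Z t ∈ Metric.closedBall 0 K
  Y_mem : ∀ t, Y t ∈ Metric.closedBall 0 K
  Q_mem : ∀ t, Q t ∈ Metric.closedBall 0 K
  C_zero : C 0 = P.C₀
  Q_zero : Q 0 = 0
  abs_C_sub_le : ∀ s t, 0 ≤ s → s ≤ t → t ≤ P.T → ∀ i, |C t i - C s i| ≤ K * (t - s)
  abs_Q_sub_le : ∀ s t, 0 ≤ s → s ≤ t → t ≤ P.T → |Q t - Q s| ≤ K * (t - s)
  le_Z_sub : ∀ s t, 0 ≤ s → s ≤ t → t ≤ P.T → ∀ i, P.xHigh⁻¹ * (t - s) ≤ Z t i - Z s i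
  Z_sub_le : ∀ s t, 0 ≤ s → s ≤ t → t ≤ P.T → ∀ i, Z t i - Z s i ≤ P.xLow⁻¹ * (t - s)
  le_Y_sub : ∀ s t, 0 ≤ s → s ≤ t → t ≤ P.T → ∀ i, P.yLow * (t - s) ≤ Y t i - Y s i
  Y_sub_le : ∀ s t, 0 ≤ s → s ≤ t → t ≤ P.T → ∀ i, Y t i - Y s i ≤ P.yHigh * (t - s)
  state : ∀ s t, 0 ≤ s → s ≤ t → t ≤ P.T → ∀ i,
    |C t i - C s i - ((Z t i - Z s i) * P.infection (C s) i - (Y t i - Y s i) * C s i)|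
      ≤ K * (t - s) ^ 2
  cost : ∀ s t, 0 ≤ s → s ≤ t → t ≤ P.T → ∀ l : Fin N → ℝ,
    ∑ i, (P.w i * C s i * (t - s) + (2 * l i * (t - s) - l i ^ 2 * (Z t i - Z s i))
      + (Y t i - Y s i)) - K * (t - s) ^ 2 ≤ Q t - Q s

theorem abs_projIcc_sub_zero_le {f : ℝ → ℝ} {T M K : ℝ} (hT : 0 ≤ T) (hf0 : f 0 = 0)
    (hf : ∀ s t, 0 ≤ s → s ≤ t → t ≤ T → |f t - f s| ≤ M * (t - s)) (hM : 0 ≤ M)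
    (hK : M * T ≤ K) (t : ℝ) : |f (projIcc 0 T hT t)| ≤ K := by
  obtain ⟨h0, h1⟩ := (projIcc 0 T hT t).2
  have := hf 0 _ le_rfl h0 h1
  rw [hf0, sub_zero, sub_zero] at this
  exact this.trans ((mul_le_mul_of_nonneg_left h1 hM).trans hK)

/-- Every state of an admissible control is the first component of a relaxed trajectory, with a
constant independent of the control, whose terminal cost is the value of the objective. -/
theorem exists_forall_state_isRelaxed (hβ : 0 < P.β) (ha : ∀ i, 0 ≤ P.a i) (hx : 0 < P.xLow)
    (hx' : P.xLow ≤ P.xHigh) (hy : 0 < P.yLow) (hT : 0 < P.T)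
    (hC₀ : ∀ i, 0 ≤ P.C₀ i ∧ P.C₀ i ≤ 1) :
    ∃ K, ∀ u ∈ P.admissible, ∀ D, P.IsState u D →
      ∃ C Z Y Q, P.IsRelaxed K C Z Y Q ∧ Q P.T = P.J u D := by
  obtain ⟨k, hk⟩ := P.exists_lipschitzOnWith_infection
  obtain ⟨M, hM⟩ := P.exists_norm_infection_le
  -- Bounds on the derivatives of the state and of the cost.
  set A : ℝ := P.xLow⁻¹ * M + |P.yHigh|
  set B : ℝ := ∑ i, (P.w i + |P.xHigh| + |P.yHigh|)
  -- Constants of the second-order errors in the state equation and in the cost.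
  set E : ℝ := (P.xLow⁻¹ * k + |P.yHigh|) * A with hE
  set W : ℝ := (∑ i, P.w i) * A with hW
  have hz : 0 < P.xLow⁻¹ := inv_pos.2 hx
  have hA0 : 0 ≤ A := by positivity
  have hw0 : 0 ≤ ∑ i, P.w i := Finset.sum_nonneg fun i _ => P.w_nonneg i
  have hB0 : 0 ≤ B := Finset.sum_nonneg fun i _ => by have := P.w_nonneg i; positivity
  have hE0 : 0 ≤ E := by positivity
  have hW0 : 0 ≤ W := by positivity
  obtain ⟨K, hK⟩ : ∃ K : ℝ, A ≤ K ∧ B ≤ K ∧ E ≤ K ∧ W ≤ K ∧ P.xLow⁻¹ * P.T ≤ K ∧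
      |P.yHigh| * P.T ≤ K ∧ B * P.T ≤ K := by
    have h1 : 0 ≤ P.xLow⁻¹ * P.T := by positivity
    have h2 : 0 ≤ |P.yHigh| * P.T := by positivity
    have h3 : 0 ≤ B * P.T := by positivity
    refine ⟨A + B + E + W + P.xLow⁻¹ * P.T + |P.yHigh| * P.T + B * P.T, ?_⟩
    refine ⟨?_, ?_, ?_, ?_, ?_, ?_, ?_⟩ <;> linarith
  obtain ⟨hAK, hBK, hEK, hWK, hZK, hYK, hQK⟩ := hK
  refine ⟨K, fun u hu D hD => ?_⟩
  have hDmem := hD.mem_Icc hβ ha hx hy hT hC₀ hu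
  have hDac (i : Fin N) := hD.absolutelyContinuous.apply i
  choose Z hZ0 _ hZac hZd using fun i =>
    (intervalIntegrable_inv_x hT.le hx hu i).exists_primitive hT.le
  choose Y hY0 _ hYac hYd using fun i =>
    (intervalIntegrable_of_Lp hT.le (u.2 i)).exists_primitive hT.le
  obtain ⟨Q, hQ0, hQT, hQac, hQd⟩ :=
    (intervalIntegrable_L hT.le u fun i => (hDac i).continuousOn).exists_primitive hT.le
  have hd : ∀ᵐ t, t ∈ Icc 0 P.T →
      (HasDerivAt Q (P.L (D t) (u.x t) (u.y t)) t) ∧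
      ∀ i, HasDerivAt (fun r => D r i) ((u.x t i)⁻¹ * P.infection (D t) i - u.y t i * D t i) t ∧
        HasDerivAt (Z i) (u.x t i)⁻¹ t ∧ HasDerivAt (Y i) (u.y t i) t ∧
        P.xLow ≤ u.x t i ∧ u.x t i ≤ P.xHigh ∧ P.yLow ≤ u.y t i ∧ u.y t i ≤ P.yHigh := by
    filter_upwards [hQd, hD.ae_hasDerivAt, ae_all_iff.2 hZd, ae_all_iff.2 hYd,
      ae_of_mem_admissible hu] with t h1 h2 h3 h4 h5 ht
    exact ⟨h1 ht, fun i => ⟨h2 ht i, h3 i ht, h4 i ht, (h5 ht i).1.1, (h5 ht i).1.2,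
      (h5 ht i).2.1, (h5 ht i).2.2⟩⟩
  clear hQd hZd hYd
  have hsub {s t : ℝ} (hs : 0 ≤ s) (hst : s ≤ t) (ht : t ≤ P.T) : Icc s t ⊆ Icc 0 P.T :=
    Icc_subset_Icc hs ht
  have husub {s t : ℝ} (hs : 0 ≤ s) (hst : s ≤ t) (ht : t ≤ P.T) : uIcc s t ⊆ uIcc 0 P.T := by
    rw [uIcc_of_le hst, uIcc_of_le hT.le]; exact hsub hs hst ht
  have hdZ : ∀ s t, 0 ≤ s → s ≤ t → t ≤ P.T → ∀ i,
      P.xHigh⁻¹ * (t - s) ≤ Z i t - Z i s ∧ Z i t - Z i s ≤ P.xLow⁻¹ * (t - s) := by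
    intro s t hs hst ht i
    have hac := (hZac i).mono (husub hs hst ht)
    constructor
    · have := hac.fun_neg.sub_le_mul_of_ae_hasDerivAt (K := -P.xHigh⁻¹) hst (by
        filter_upwards [hd] with r hr hrm
        obtain ⟨-, h⟩ := hr (hsub hs hst ht hrm)
        obtain ⟨-, h1, -, h2, h3, -⟩ := h i
        exact ⟨_, h1.fun_neg, neg_le_neg (inv_anti₀ (hx.trans_le h2) h3)⟩)
      linarith
    · refine hac.sub_le_mul_of_ae_hasDerivAt hst ?_
      filter_upwards [hd] with r hr hrm
      obtain ⟨-, h⟩ := hr (hsub hs hst ht hrm)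
      obtain ⟨-, h1, -, h2, -⟩ := h i
      exact ⟨_, h1, inv_anti₀ hx h2⟩
  have hdY : ∀ s t, 0 ≤ s → s ≤ t → t ≤ P.T → ∀ i,
      P.yLow * (t - s) ≤ Y i t - Y i s ∧ Y i t - Y i s ≤ P.yHigh * (t - s) := by
    intro s t hs hst ht i
    have hac := (hYac i).mono (husub hs hst ht)
    constructor
    · have := hac.fun_neg.sub_le_mul_of_ae_hasDerivAt (K := -P.yLow) hst (by
        filter_upwards [hd] with r hr hrm
        obtain ⟨-, h⟩ := hr (hsub hs hst ht hrm)
        obtain ⟨-, -, h1, -, -, h2, -⟩ := h i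
        exact ⟨_, h1.fun_neg, neg_le_neg h2⟩)
      linarith
    · refine hac.sub_le_mul_of_ae_hasDerivAt hst ?_
      filter_upwards [hd] with r hr hrm
      obtain ⟨-, h⟩ := hr (hsub hs hst ht hrm)
      obtain ⟨-, -, h1, -, -, -, h2⟩ := h i
      exact ⟨_, h1, h2⟩
  have hdD : ∀ s t, 0 ≤ s → s ≤ t → t ≤ P.T → ∀ i, |D t i - D s i| ≤ A * (t - s) := by
    intro s t hs hst ht i
    refine ((hDac i).mono (husub hs hst ht)).abs_sub_le_mul_of_ae_hasDerivAt hst ?_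
    filter_upwards [hd] with r hr hrm
    have hrm' := hsub hs hst ht hrm
    obtain ⟨-, h⟩ := hr hrm'
    obtain ⟨h1, -, -, h2, -, h3, h4⟩ := h i
    refine ⟨_, h1, (abs_sub _ _).trans ?_⟩
    rw [abs_mul, abs_mul, abs_of_nonneg (inv_pos.2 (hx.trans_le h2)).le,
      abs_of_nonneg (hy.le.trans h3), abs_of_nonneg ((hDmem r hrm').1 i)]
    refine add_le_add (mul_le_mul (inv_anti₀ hx h2)
      ((norm_le_pi_norm (P.infection (D r)) i).trans (hM _ (hDmem r hrm'))) (abs_nonneg _) hz.le) ?_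
    have h5 : D r i ≤ 1 := (hDmem r hrm').2 i
    have h6 := (hDmem r hrm').1 i
    calc u.y r i * D r i ≤ u.y r i * 1 := mul_le_mul_of_nonneg_left h5 (hy.le.trans h3)
      _ ≤ |P.yHigh| := by rw [mul_one]; exact h4.trans (le_abs_self _)
  have hdQ : ∀ s t, 0 ≤ s → s ≤ t → t ≤ P.T → |Q t - Q s| ≤ B * (t - s) := by
    intro s t hs hst ht
    refine (hQac.mono (husub hs hst ht)).abs_sub_le_mul_of_ae_hasDerivAt hst ?_
    filter_upwards [hd] with r hr hrm
    have hrm' := hsub hs hst ht hrm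
    obtain ⟨h0, h⟩ := hr hrm'
    refine ⟨_, h0, (Finset.abs_sum_le_sum_abs _ _).trans (Finset.sum_le_sum fun i _ => ?_)⟩
    obtain ⟨-, -, -, h2, h2', h3, h4⟩ := h i
    have h5 : D r i ≤ 1 := (hDmem r hrm').2 i
    have h6 : 0 ≤ D r i := (hDmem r hrm').1 i
    have h7 := mul_le_mul_of_nonneg_left h5 (P.w_nonneg i)
    have h8 := mul_nonneg (P.w_nonneg i) h6
    have h9 := le_abs_self P.xHigh
    have h10 := le_abs_self P.yHigh
    rw [abs_of_nonneg (by linarith)]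
    linarith
  have hnorm : ∀ s r, 0 ≤ s → s ≤ r → r ≤ P.T → ‖D r - D s‖ ≤ A * (r - s) := by
    intro s r hs hsr hr
    exact (pi_norm_le_iff_of_nonneg (mul_nonneg hA0 (sub_nonneg.2 hsr))).2 fun i =>
      hdD s r hs hsr hr i
  have hstate : ∀ s t, 0 ≤ s → s ≤ t → t ≤ P.T → ∀ i,
      |D t i - D s i - ((Z i t - Z i s) * P.infection (D s) i - (Y i t - Y i s) * D s i)|
        ≤ E * (t - s) ^ 2 := by
    intro s t hs hst ht i
    have hac : AbsolutelyContinuousOnInterval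
        (fun r => D r i - (P.infection (D s) i * Z i r - D s i * Y i r)) s t :=
      ((hDac i).mono (husub hs hst ht)).fun_sub
        ((((hZac i).mono (husub hs hst ht)).const_mul _).fun_sub
          (((hYac i).mono (husub hs hst ht)).const_mul _))
    have := hac.abs_sub_le_mul_of_ae_hasDerivAt (K := E * (t - s)) hst (by
      filter_upwards [hd] with r hr hrm
      have hrm' := hsub hs hst ht hrm
      obtain ⟨-, h⟩ := hr hrm'
      obtain ⟨h1, hz1, hy1, h2, -, h3, h4⟩ := h i
      refine ⟨_, h1.fun_sub ((hz1.const_mul _).fun_sub (hy1.const_mul _)), ?_⟩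
      have hs' : s ∈ Icc 0 P.T := ⟨hs, hst.trans ht⟩
      have hn := hnorm s r hs hrm.1 (hrm.2.trans ht)
      have e1 : |P.infection (D r) i - P.infection (D s) i| ≤ k * (A * (r - s)) := by
        have h5 := hk.norm_sub_le (hDmem r hrm') (hDmem s hs')
        have h6 := norm_le_pi_norm (P.infection (D r) - P.infection (D s)) i
        exact h6.trans (h5.trans (mul_le_mul_of_nonneg_left hn k.2))
      have e2 : |D r i - D s i| ≤ A * (r - s) := hdD s r hs hrm.1 (hrm.2.trans ht) i
      have e3 : A * (r - s) ≤ A * (t - s) :=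
        mul_le_mul_of_nonneg_left (by linarith [hrm.2]) hA0
      have e4 : (u.x r i)⁻¹ * P.infection (D r) i - u.y r i * D r i
          - (P.infection (D s) i * (u.x r i)⁻¹ - D s i * u.y r i)
          = (u.x r i)⁻¹ * (P.infection (D r) i - P.infection (D s) i)
            - u.y r i * (D r i - D s i) := by ring
      rw [e4]
      refine (abs_sub _ _).trans ?_
      rw [abs_mul, abs_mul, abs_of_nonneg (inv_pos.2 (hx.trans_le h2)).le,
        abs_of_nonneg (hy.le.trans h3)]
      have e5 := mul_le_mul (inv_anti₀ hx h2) (e1.trans (mul_le_mul_of_nonneg_left e3 k.2))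
        (abs_nonneg _) hz.le
      have e6 := mul_le_mul (h4.trans (le_abs_self _)) (e2.trans e3) (abs_nonneg _)
        (abs_nonneg _)
      refine (add_le_add e5 e6).trans (le_of_eq ?_)
      rw [hE]; ring)
    convert! this using 1
    · congr 1; ring
    · ring
  have hcost : ∀ s t, 0 ≤ s → s ≤ t → t ≤ P.T → ∀ l : Fin N → ℝ,
      ∑ i, (P.w i * D s i * (t - s) + (2 * l i * (t - s) - l i ^ 2 * (Z i t - Z i s))
        + (Y i t - Y i s)) - W * (t - s) ^ 2 ≤ Q t - Q s := by
    intro s t hs hst ht l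
    have hac : AbsolutelyContinuousOnInterval
        (fun r => (∑ i, (Y i r - l i ^ 2 * Z i r)) - Q r) s t :=
      (AbsolutelyContinuousOnInterval.finset_sum _ fun i _ =>
        ((hYac i).mono (husub hs hst ht)).fun_sub
          (((hZac i).mono (husub hs hst ht)).const_mul _)).fun_sub (hQac.mono (husub hs hst ht))
    have := hac.sub_le_mul_of_ae_hasDerivAt
      (K := W * (t - s) - ∑ i, (P.w i * D s i + 2 * l i)) hst (by
      filter_upwards [hd] with r hr hrm
      have hrm' := hsub hs hst ht hrm
      obtain ⟨hq, h⟩ := hr hrm'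
      refine ⟨_, (HasDerivAt.fun_sum fun i _ =>
        ((h i).2.2.1.fun_sub ((h i).2.1.const_mul (l i ^ 2)))).fun_sub hq, ?_⟩
      have hterm : ∀ i ∈ Finset.univ, (u.y r i - l i ^ 2 * (u.x r i)⁻¹)
          - (P.w i * D r i + u.x r i + u.y r i) + (P.w i * D s i + 2 * l i)
          ≤ P.w i * (A * (t - s)) := by
        intro i _
        have hxpos : 0 < u.x r i := hx.trans_le (h i).2.2.2.1
        -- the tangent inequality `2 * l - l ^ 2 / x ≤ x`
        have htan : 2 * l i - l i ^ 2 * (u.x r i)⁻¹ ≤ u.x r i := by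
          have : u.x r i - (2 * l i - l i ^ 2 * (u.x r i)⁻¹)
              = (u.x r i - l i) ^ 2 * (u.x r i)⁻¹ := by
            field_simp; ring
          have : 0 ≤ (u.x r i - l i) ^ 2 * (u.x r i)⁻¹ := by positivity
          linarith
        have hDi : D s i - D r i ≤ A * (t - s) := by
          have h1 := neg_le_of_abs_le (hdD s r hs hrm.1 (hrm.2.trans ht) i)
          have h2 := mul_le_mul_of_nonneg_left (sub_le_sub_right hrm.2 s) hA0
          linarith
        have := mul_le_mul_of_nonneg_left hDi (P.w_nonneg i)
        linarith
      have hsum := Finset.sum_le_sum hterm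
      rw [Finset.sum_add_distrib, Finset.sum_sub_distrib, ← Finset.sum_mul] at hsum
      simp only [L]
      have hWt : W * (t - s) = (∑ i, P.w i) * (A * (t - s)) := by rw [hW]; ring
      rw [hWt]
      linarith)
    have e : ∑ i, (P.w i * D s i * (t - s) + (2 * l i * (t - s) - l i ^ 2 * (Z i t - Z i s))
        + (Y i t - Y i s)) = (∑ i, (P.w i * D s i + 2 * l i)) * (t - s)
          + ((∑ i, (Y i t - l i ^ 2 * Z i t)) - ∑ i, (Y i s - l i ^ 2 * Z i s)) := by
      rw [Finset.sum_mul, ← Finset.sum_sub_distrib, ← Finset.sum_add_distrib]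
      exact Finset.sum_congr rfl fun i _ => by ring
    rw [e]
    linarith
  -- The functions are extended from `[0, T]` to the real line by constants.
  let π : ℝ → ℝ := fun t => projIcc 0 P.T hT.le t
  have hπ : ∀ {t}, 0 ≤ t → t ≤ P.T → π t = t := fun h0 h1 => by
    simp only [π]; rw [projIcc_of_mem hT.le ⟨h0, h1⟩]
  have hstep {a b c : ℝ} (hab : a ≤ b) (hc : 0 ≤ c) : a * c ≤ b * c :=
    mul_le_mul_of_nonneg_right hab hc
  have hK0 : 0 ≤ K := hA0.trans hAK
  refine ⟨fun t => D (π t), fun t i => Z i (π t), fun t i => Y i (π t), fun t => Q (π t),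
    ⟨fun t => hDmem _ (projIcc 0 P.T hT.le t).2, fun t => ?_, fun t => ?_, fun t => ?_, ?_, ?_,
    ?_, ?_, ?_, ?_, ?_, ?_, ?_, ?_⟩, ?_⟩
  · rw [mem_closedBall_zero_iff, pi_norm_le_iff_of_nonneg hK0]
    refine fun i => abs_projIcc_sub_zero_le hT.le (hZ0 i) (fun s t hs hst ht => ?_) hz.le hZK t
    obtain ⟨h1, h2⟩ := hdZ s t hs hst ht i
    rw [abs_of_nonneg]
    · exact h2
    · refine (mul_nonneg ?_ (sub_nonneg.2 hst)).trans h1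
      exact inv_nonneg.2 (hx.le.trans hx')
  · rw [mem_closedBall_zero_iff, pi_norm_le_iff_of_nonneg hK0]
    refine fun i => abs_projIcc_sub_zero_le hT.le (hY0 i) (fun s t hs hst ht => ?_)
      (abs_nonneg _) hYK t
    obtain ⟨h1, h2⟩ := hdY s t hs hst ht i
    have h3 := mul_nonneg hy.le (sub_nonneg.2 hst)
    rw [abs_of_nonneg (h3.trans h1)]
    exact h2.trans (hstep (le_abs_self _) (sub_nonneg.2 hst))
  · rw [mem_closedBall_zero_iff]
    exact abs_projIcc_sub_zero_le hT.le hQ0 hdQ hB0 hQK t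
  · simp only [hπ le_rfl hT.le, hD.initial]
  · simp only [hπ le_rfl hT.le, hQ0]
  · intro s t hs hst ht i
    simp only [hπ hs (hst.trans ht), hπ (hs.trans hst) ht]
    exact (hdD s t hs hst ht i).trans (hstep hAK (sub_nonneg.2 hst))
  · intro s t hs hst ht
    simp only [hπ hs (hst.trans ht), hπ (hs.trans hst) ht]
    exact (hdQ s t hs hst ht).trans (hstep hBK (sub_nonneg.2 hst))
  · intro s t hs hst ht i
    simp only [hπ hs (hst.trans ht), hπ (hs.trans hst) ht]
    exact (hdZ s t hs hst ht i).1
  · intro s t hs hst ht i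
    simp only [hπ hs (hst.trans ht), hπ (hs.trans hst) ht]
    exact (hdZ s t hs hst ht i).2
  · intro s t hs hst ht i
    simp only [hπ hs (hst.trans ht), hπ (hs.trans hst) ht]
    exact (hdY s t hs hst ht i).1
  · intro s t hs hst ht i
    simp only [hπ hs (hst.trans ht), hπ (hs.trans hst) ht]
    exact (hdY s t hs hst ht i).2
  · intro s t hs hst ht i
    simp only [hπ hs (hst.trans ht), hπ (hs.trans hst) ht]
    exact (hstate s t hs hst ht i).trans (hstep hEK (sq_nonneg _))
  · intro s t hs hst ht l
    simp only [hπ hs (hst.trans ht), hπ (hs.trans hst) ht]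
    have := hcost s t hs hst ht l
    have := hstep hWK (sq_nonneg (t - s))
    linarith
  · simp only [hπ hT.le le_rfl, hQT, J]

end APT.Problem

/-! ### From relaxed trajectories to controls, and compactness -/

namespace APT.Problem

variable {N : ℕ} {P : Problem N}

theorem lipschitzOnWith_Icc_of_abs_sub_le {f : ℝ → ℝ} {T K : ℝ}
    (hf : ∀ s t, 0 ≤ s → s ≤ t → t ≤ T → |f t - f s| ≤ K * (t - s)) :
    LipschitzOnWith K.toNNReal f (Icc 0 T) := by
  refine LipschitzOnWith.of_dist_le_mul fun s hs t ht => ?_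
  wlog hst : s ≤ t generalizing s t
  · rw [dist_comm, dist_comm s]
    exact this t ht s hs (le_of_not_ge hst)
  rw [dist_comm, dist_comm s, Real.dist_eq, Real.dist_eq, abs_of_nonneg (sub_nonneg.2 hst)]
  exact (hf s t hs.1 hst ht.2).trans
    (mul_le_mul_of_nonneg_right (Real.le_coe_toNNReal K) (sub_nonneg.2 hst))

theorem absolutelyContinuousOnInterval_of_abs_sub_le {f : ℝ → ℝ} {T K : ℝ} (hT : 0 ≤ T)
    (hf : ∀ s t, 0 ≤ s → s ≤ t → t ≤ T → |f t - f s| ≤ K * (t - s)) :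
    AbsolutelyContinuousOnInterval f 0 T := by
  have := lipschitzOnWith_Icc_of_abs_sub_le hf
  rw [← uIcc_of_le hT] at this
  exact this.absolutelyContinuousOnInterval

namespace IsRelaxed

variable {K : ℝ} {C Z Y : ℝ → Fin N → ℝ} {Q : ℝ → ℝ}

theorem C_ac (h : P.IsRelaxed K C Z Y Q) (hT : 0 ≤ P.T) :
    AbsolutelyContinuousOnInterval C 0 P.T := by
  have hlip : LipschitzOnWith K.toNNReal C (Icc 0 P.T) := by
    refine LipschitzOnWith.of_dist_le_mul fun s hs t ht => ?_
    exact (dist_pi_le_iff (by positivity)).2 fun i => (lipschitzOnWith_Icc_of_abs_sub_le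
      fun s t hs hst ht => h.abs_C_sub_le s t hs hst ht i).dist_le_mul s hs t ht
  rw [← uIcc_of_le hT] at hlip
  exact hlip.absolutelyContinuousOnInterval

theorem Z_ac (h : P.IsRelaxed K C Z Y Q) (hT : 0 ≤ P.T) (i : Fin N) :
    AbsolutelyContinuousOnInterval (fun t => Z t i) 0 P.T := by
  refine absolutelyContinuousOnInterval_of_abs_sub_le (K := |P.xHigh⁻¹| + |P.xLow⁻¹|) hT
    fun s t hs hst ht => ?_
  have h1 := h.le_Z_sub s t hs hst ht i
  have h2 := h.Z_sub_le s t hs hst ht i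
  have h3 := mul_le_mul_of_nonneg_right (neg_abs_le P.xHigh⁻¹) (sub_nonneg.2 hst)
  have h4 := mul_le_mul_of_nonneg_right (le_abs_self P.xLow⁻¹) (sub_nonneg.2 hst)
  have h5 := mul_nonneg (abs_nonneg P.xHigh⁻¹) (sub_nonneg.2 hst)
  have h6 := mul_nonneg (abs_nonneg P.xLow⁻¹) (sub_nonneg.2 hst)
  exact abs_le.2 ⟨by linarith, by linarith⟩

theorem Y_ac (h : P.IsRelaxed K C Z Y Q) (hT : 0 ≤ P.T) (i : Fin N) :
    AbsolutelyContinuousOnInterval (fun t => Y t i) 0 P.T := by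
  refine absolutelyContinuousOnInterval_of_abs_sub_le (K := |P.yLow| + |P.yHigh|) hT
    fun s t hs hst ht => ?_
  have h1 := h.le_Y_sub s t hs hst ht i
  have h2 := h.Y_sub_le s t hs hst ht i
  have h3 := mul_le_mul_of_nonneg_right (neg_abs_le P.yLow) (sub_nonneg.2 hst)
  have h4 := mul_le_mul_of_nonneg_right (le_abs_self P.yHigh) (sub_nonneg.2 hst)
  have h5 := mul_nonneg (abs_nonneg P.yLow) (sub_nonneg.2 hst)
  have h6 := mul_nonneg (abs_nonneg P.yHigh) (sub_nonneg.2 hst)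
  exact abs_le.2 ⟨by linarith, by linarith⟩

theorem Q_ac (h : P.IsRelaxed K C Z Y Q) (hT : 0 ≤ P.T) :
    AbsolutelyContinuousOnInterval Q 0 P.T :=
  absolutelyContinuousOnInterval_of_abs_sub_le hT h.abs_Q_sub_le

/-- The derivatives of a relaxed trajectory, at a time where they exist. -/
theorem deriv_bounds (h : P.IsRelaxed K C Z Y Q) {s : ℝ} (hs : s ∈ Ioo 0 P.T) {c z y : Fin N → ℝ}
    {q : ℝ} (hc : ∀ i, HasDerivAt (fun t => C t i) (c i) s)
    (hz : ∀ i, HasDerivAt (fun t => Z t i) (z i) s)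
    (hy : ∀ i, HasDerivAt (fun t => Y t i) (y i) s) (hq : HasDerivAt Q q s) :
    (∀ i, (P.xHigh⁻¹ ≤ z i ∧ z i ≤ P.xLow⁻¹) ∧ (P.yLow ≤ y i ∧ y i ≤ P.yHigh) ∧
      c i = z i * P.infection (C s) i - y i * C s i) ∧
    ∀ l : Fin N → ℝ, ∑ i, (P.w i * C s i + (2 * l i - l i ^ 2 * z i) + y i) ≤ q := by
  refine ⟨fun i => ⟨⟨?_, ?_⟩, ⟨?_, ?_⟩, ?_⟩, fun l => ?_⟩
  · refine le_of_hasDerivAt_of_sub_sq_le (K := 0) hs.2 (hz i) fun t ht => ?_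
    have := h.le_Z_sub s t hs.1.le ht.1.le ht.2.le i
    linarith
  · refine neg_le_neg_iff.1 (le_of_hasDerivAt_of_sub_sq_le (K := 0) hs.2 (hz i).fun_neg
      fun t ht => ?_)
    have := h.Z_sub_le s t hs.1.le ht.1.le ht.2.le i
    linarith
  · refine le_of_hasDerivAt_of_sub_sq_le (K := 0) hs.2 (hy i) fun t ht => ?_
    have := h.le_Y_sub s t hs.1.le ht.1.le ht.2.le i
    linarith
  · refine neg_le_neg_iff.1 (le_of_hasDerivAt_of_sub_sq_le (K := 0) hs.2 (hy i).fun_neg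
      fun t ht => ?_)
    have := h.Y_sub_le s t hs.1.le ht.1.le ht.2.le i
    linarith
  · have hd := (hc i).fun_sub
      (((hz i).mul_const (P.infection (C s) i)).fun_sub ((hy i).mul_const (C s i)))
    have h1 : 0 ≤ c i - (z i * P.infection (C s) i - y i * C s i) := by
      refine le_of_hasDerivAt_of_sub_sq_le (K := K) hs.2 hd fun t ht => ?_
      have := neg_le_of_abs_le (h.state s t hs.1.le ht.1.le ht.2.le i)
      linarith
    have h2 : 0 ≤ -(c i - (z i * P.infection (C s) i - y i * C s i)) := by
      refine le_of_hasDerivAt_of_sub_sq_le (K := K) hs.2 hd.fun_neg fun t ht => ?_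
      have := le_of_abs_le (h.state s t hs.1.le ht.1.le ht.2.le i)
      linarith
    linarith
  · have hd := hq.fun_sub (HasDerivAt.fun_sum (u := Finset.univ) fun i _ =>
      (hy i).fun_sub ((hz i).const_mul (l i ^ 2)))
    have h1 := le_of_hasDerivAt_of_sub_sq_le (K := K)
      (m := ∑ i, (P.w i * C s i + 2 * l i)) hs.2 hd fun t ht => by
        have := h.cost s t hs.1.le ht.1.le ht.2.le l
        have e : ∑ i, (P.w i * C s i * (t - s) + (2 * l i * (t - s) - l i ^ 2 * (Z t i - Z s i))
            + (Y t i - Y s i)) = (∑ i, (P.w i * C s i + 2 * l i)) * (t - s)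
              + ((∑ i, (Y t i - l i ^ 2 * Z t i)) - ∑ i, (Y s i - l i ^ 2 * Z s i)) := by
          rw [Finset.sum_mul, ← Finset.sum_sub_distrib, ← Finset.sum_add_distrib]
          exact Finset.sum_congr rfl fun i _ => by ring
        linarith
    have e : ∑ i, (P.w i * C s i + (2 * l i - l i ^ 2 * z i) + y i)
        = ∑ i, (P.w i * C s i + 2 * l i) + ∑ i, (y i - l i ^ 2 * z i) := by
      rw [← Finset.sum_add_distrib]
      exact Finset.sum_congr rfl fun i _ => by ring
    linarith

/-- The first component of a relaxed trajectory is a state for the controls `1 / Z'` and `Y'`, and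
its objective value is at most the terminal value of `Q`. -/
theorem exists_control (h : P.IsRelaxed K C Z Y Q) (hx : 0 < P.xLow) (hx' : P.xLow ≤ P.xHigh)
    (hT : 0 < P.T) : ∃ u ∈ P.admissible, P.IsState u C ∧ P.J u C ≤ Q P.T := by
  let z : Fin N → ℝ → ℝ := fun i => deriv fun t => Z t i
  let y : Fin N → ℝ → ℝ := fun i => deriv fun t => Y t i
  have hCac := h.C_ac hT.le
  have hQac := h.Q_ac hT.le
  have hd : ∀ᵐ t, t ∈ Icc 0 P.T →
      HasDerivAt C (deriv C t) t ∧ HasDerivAt Q (deriv Q t) t ∧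
      (∀ i, (P.xHigh⁻¹ ≤ z i t ∧ z i t ≤ P.xLow⁻¹) ∧ (P.yLow ≤ y i t ∧ y i t ≤ P.yHigh) ∧
      deriv C t i = z i t * P.infection (C t) i - y i t * C t i) ∧
      ∀ l : Fin N → ℝ,
        ∑ i, (P.w i * C t i + (2 * l i - l i ^ 2 * z i t) + y i t) ≤ deriv Q t := by
    filter_upwards [ae_all_iff.2 fun i => (hCac.apply i).ae_differentiableAt,
      ae_all_iff.2 fun i => (h.Z_ac hT.le i).ae_differentiableAt,
      ae_all_iff.2 fun i => (h.Y_ac hT.le i).ae_differentiableAt, hQac.ae_differentiableAt,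
      ae_mem_Icc_imp_mem_Ioo 0 P.T] with t h1 h2 h3 h4 h5 ht
    rw [uIcc_of_le hT.le] at h1 h2 h3 h4
    have hC : HasDerivAt C (deriv C t) t :=
      (differentiableAt_pi.2 fun i => h1 i ht).hasDerivAt
    exact ⟨hC, (h4 ht).hasDerivAt, h.deriv_bounds (h5 ht) (hasDerivAt_pi.1 hC)
      (fun i => (h2 i ht).hasDerivAt) (fun i => (h3 i ht).hasDerivAt) (h4 ht).hasDerivAt⟩
  have hxb {r : ℝ} (h1 : P.xHigh⁻¹ ≤ r) (h2 : r ≤ P.xLow⁻¹) :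
      0 < r ∧ P.xLow ≤ r⁻¹ ∧ r⁻¹ ≤ P.xHigh := by
    have hr : 0 < r := (inv_pos.2 (hx.trans_le hx')).trans_le h1
    exact ⟨hr, (le_inv_comm₀ hx hr).2 h2, (inv_le_comm₀ hr (hx.trans_le hx')).2 h1⟩
  have hd' := (ae_restrict_iff' (μ := volume) measurableSet_Icc).2 hd
  have hxm (i : Fin N) : MemLp (fun t => (z i t)⁻¹) 2 (volume.restrict (Icc 0 P.T)) := by
    refine MemLp.of_bound (measurable_deriv _).inv.aestronglyMeasurable P.xHigh ?_
    filter_upwards [hd'] with t ht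
    obtain ⟨⟨h1, h2⟩, -⟩ := ht.2.2.1 i
    obtain ⟨h3, -, h4⟩ := hxb h1 h2
    rwa [Real.norm_of_nonneg (inv_pos.2 h3).le]
  have hym (i : Fin N) : MemLp (y i) 2 (volume.restrict (Icc 0 P.T)) := by
    refine MemLp.of_bound (measurable_deriv _).aestronglyMeasurable (|P.yLow| + |P.yHigh|) ?_
    filter_upwards [hd'] with t ht
    obtain ⟨-, ⟨h1, h2⟩, -⟩ := ht.2.2.1 i
    have h3 := neg_abs_le P.yLow
    have h4 := le_abs_self P.yHigh
    have h5 := abs_nonneg P.yLow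
    have h6 := abs_nonneg P.yHigh
    exact abs_le.2 ⟨by linarith, by linarith⟩
  let u : P.Control := (fun i => (hxm i).toLp _, fun i => (hym i).toLp _)
  have hux : ∀ᵐ t ∂volume.restrict (Icc 0 P.T), u.x t = fun i => (z i t)⁻¹ := by
    filter_upwards [ae_all_iff.2 fun i => (hxm i).coeFn_toLp] with t ht
    exact funext ht
  have huy : ∀ᵐ t ∂volume.restrict (Icc 0 P.T), u.y t = fun i => y i t := by
    filter_upwards [ae_all_iff.2 fun i => (hym i).coeFn_toLp] with t ht
    exact funext ht
  refine ⟨u, ?_, ⟨hCac, ?_, h.C_zero⟩, ?_⟩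
  · filter_upwards [hux, huy, hd'] with t h1 h2 ht i
    obtain ⟨⟨h3, h4⟩, h5, -⟩ := ht.2.2.1 i
    rw [h1, h2]
    exact ⟨(hxb h3 h4).2, h5⟩
  · filter_upwards [hux, huy, hd'] with t h1 h2 ht
    convert! ht.1 using 1
    funext i
    rw [F_eq, h1, h2, (ht.2.2.1 i).2.2, inv_inv]
  · have hle : P.J u C ≤ ∫ t in (0 : ℝ)..P.T, deriv Q t := by
      refine intervalIntegral.integral_mono_ae_restrict hT.le
        (intervalIntegrable_L hT.le u fun i => (hCac.apply i).continuousOn)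
        hQac.intervalIntegrable_deriv ?_
      filter_upwards [hux, huy, hd'] with t h1 h2 ht
      -- The tangent to `z ↦ 1 / z` at `Z'` itself has slope parameter `l = 1 / Z'`.
      refine le_of_eq_of_le ?_ (ht.2.2.2 fun i => (z i t)⁻¹)
      simp only [L, h1, h2]
      refine Finset.sum_congr rfl fun i _ => ?_
      have := (hxb (ht.2.2.1 i).1.1 (ht.2.2.1 i).1.2).1.ne'
      field_simp
      ring
    rwa [hQac.integral_deriv_eq_sub, h.Q_zero, sub_zero] at hle

end IsRelaxed

variable (P) in
/-- Relaxed trajectories form a compact set for the topology of pointwise convergence. -/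
theorem isCompact_isRelaxed (K : ℝ) :
    IsCompact {p : (ℝ → Fin N → ℝ) × (ℝ → Fin N → ℝ) × (ℝ → Fin N → ℝ) × (ℝ → ℝ) |
      P.IsRelaxed K p.1 p.2.1 p.2.2.1 p.2.2.2} := by
  have hball : IsCompact (univ.pi fun _ : ℝ => Metric.closedBall (0 : Fin N → ℝ) K) :=
    isCompact_univ_pi fun _ => isCompact_closedBall _ _
  refine ((isCompact_univ_pi fun _ : ℝ => isCompact_Icc (a := (0 : Fin N → ℝ)) (b := 1)).prod
    (hball.prod (hball.prod (isCompact_univ_pi fun _ : ℝ =>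
      isCompact_closedBall (0 : ℝ) K)))).of_isClosed_subset ?_ ?_
  · have hinf := P.contDiff_infection.continuous
    have hset : {p : (ℝ → Fin N → ℝ) × (ℝ → Fin N → ℝ) × (ℝ → Fin N → ℝ) × (ℝ → ℝ) |
        P.IsRelaxed K p.1 p.2.1 p.2.2.1 p.2.2.2} = {p |
        (∀ t, p.1 t ∈ Icc 0 1) ∧ (∀ t, p.2.1 t ∈ Metric.closedBall 0 K) ∧
        (∀ t, p.2.2.1 t ∈ Metric.closedBall 0 K) ∧ (∀ t, p.2.2.2 t ∈ Metric.closedBall 0 K) ∧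
        p.1 0 = P.C₀ ∧ p.2.2.2 0 = 0 ∧
        ∀ s t, 0 ≤ s → s ≤ t → t ≤ P.T →
          (∀ i, |p.1 t i - p.1 s i| ≤ K * (t - s)) ∧ |p.2.2.2 t - p.2.2.2 s| ≤ K * (t - s) ∧
          (∀ i, P.xHigh⁻¹ * (t - s) ≤ p.2.1 t i - p.2.1 s i) ∧
          (∀ i, p.2.1 t i - p.2.1 s i ≤ P.xLow⁻¹ * (t - s)) ∧
          (∀ i, P.yLow * (t - s) ≤ p.2.2.1 t i - p.2.2.1 s i) ∧
          (∀ i, p.2.2.1 t i - p.2.2.1 s i ≤ P.yHigh * (t - s)) ∧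
          (∀ i, |p.1 t i - p.1 s i - ((p.2.1 t i - p.2.1 s i) * P.infection (p.1 s) i
            - (p.2.2.1 t i - p.2.2.1 s i) * p.1 s i)| ≤ K * (t - s) ^ 2) ∧
          ∀ l : Fin N → ℝ, ∑ i, (P.w i * p.1 s i * (t - s)
            + (2 * l i * (t - s) - l i ^ 2 * (p.2.1 t i - p.2.1 s i))
            + (p.2.2.1 t i - p.2.2.1 s i)) - K * (t - s) ^ 2 ≤ p.2.2.2 t - p.2.2.2 s} := by
      ext p
      constructor
      · rintro ⟨h1, h2, h3, h4, h5, h6, h7, h8, h9, h10, h11, h12, h13, h14⟩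
        exact ⟨h1, h2, h3, h4, h5, h6, fun s t a b c => ⟨h7 s t a b c, h8 s t a b c,
          h9 s t a b c, h10 s t a b c, h11 s t a b c, h12 s t a b c, h13 s t a b c,
          h14 s t a b c⟩⟩
      · rintro ⟨h1, h2, h3, h4, h5, h6, h⟩
        exact ⟨h1, h2, h3, h4, h5, h6, fun s t a b c => (h s t a b c).1,
          fun s t a b c => (h s t a b c).2.1, fun s t a b c => (h s t a b c).2.2.1,
          fun s t a b c => (h s t a b c).2.2.2.1, fun s t a b c => (h s t a b c).2.2.2.2.1,
          fun s t a b c => (h s t a b c).2.2.2.2.2.1,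
          fun s t a b c => (h s t a b c).2.2.2.2.2.2.1,
          fun s t a b c => (h s t a b c).2.2.2.2.2.2.2⟩
    rw [hset]
    have hinf' (s : ℝ) (i : Fin N) : Continuous
        fun p : (ℝ → Fin N → ℝ) × (ℝ → Fin N → ℝ) × (ℝ → Fin N → ℝ) × (ℝ → ℝ) =>
          P.infection (p.1 s) i :=
      (continuous_apply i).comp (hinf.comp ((continuous_apply s).comp continuous_fst))
    simp only [ofPred_and, ofPred_forall]
    refine IsClosed.inter ?_ <| IsClosed.inter ?_ <| IsClosed.inter ?_ <| IsClosed.inter ?_ <|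
      IsClosed.inter ?_ <| IsClosed.inter ?_ ?_
    · exact isClosed_iInter fun t => isClosed_Icc.preimage (by fun_prop)
    · exact isClosed_iInter fun t => Metric.isClosed_closedBall.preimage (by fun_prop)
    · exact isClosed_iInter fun t => Metric.isClosed_closedBall.preimage (by fun_prop)
    · exact isClosed_iInter fun t => Metric.isClosed_closedBall.preimage (by fun_prop)
    · exact isClosed_eq (by fun_prop) (by fun_prop)
    · exact isClosed_eq (by fun_prop) (by fun_prop)
    · refine isClosed_iInter fun s => isClosed_iInter fun t => isClosed_iInter fun _ =>
        isClosed_iInter fun _ => isClosed_iInter fun _ => ?_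
      refine IsClosed.inter ?_ <| IsClosed.inter ?_ <| IsClosed.inter ?_ <| IsClosed.inter ?_ <|
        IsClosed.inter ?_ <| IsClosed.inter ?_ <| IsClosed.inter ?_ ?_
      · exact isClosed_iInter fun i => isClosed_le (by fun_prop) (by fun_prop)
      · exact isClosed_le (by fun_prop) (by fun_prop)
      · exact isClosed_iInter fun i => isClosed_le (by fun_prop) (by fun_prop)
      · exact isClosed_iInter fun i => isClosed_le (by fun_prop) (by fun_prop)
      · exact isClosed_iInter fun i => isClosed_le (by fun_prop) (by fun_prop)
      · exact isClosed_iInter fun i => isClosed_le (by fun_prop) (by fun_prop)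
      · refine isClosed_iInter fun i => isClosed_le ?_ (by fun_prop)
        have := hinf' s i
        fun_prop
      · exact isClosed_iInter fun l => isClosed_le (by fun_prop) (by fun_prop)
  · intro p hp
    exact ⟨fun t _ => hp.C_mem t, fun t _ => hp.Z_mem t, fun t _ => hp.Y_mem t,
      fun t _ => hp.Q_mem t⟩

end APT.Problem

theorem theorem1 {N : ℕ} (P : APT.Problem N)
    (hT : 0 < P.T) (hβ : 0 < P.β) (ha : ∀ i, 0 ≤ P.a i)
    (hx : 0 < P.xLow) (hx' : P.xLow ≤ P.xHigh)
    (hy : 0 < P.yLow) (hy' : P.yLow ≤ P.yHigh)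
    (hC₀ : ∀ i, 0 ≤ P.C₀ i ∧ P.C₀ i ≤ 1) :
    ∃ u : P.Control, P.IsOptimalControl u := by
  obtain ⟨K, hK⟩ := APT.Problem.exists_forall_state_isRelaxed hβ ha hx hx' hy hT hC₀
  obtain ⟨v, hv, D, hD⟩ := APT.Problem.exists_state hβ ha hx hx' hy hy' hT hC₀
  obtain ⟨C₁, Z₁, Y₁, Q₁, h₁, -⟩ := hK v hv D hD
  obtain ⟨⟨C, Z, Y, Q⟩, hp, hmin⟩ := (P.isCompact_isRelaxed K).exists_isMinOn
    ⟨(C₁, Z₁, Y₁, Q₁), h₁⟩ (f := fun p => p.2.2.2 P.T) (by fun_prop)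
  obtain ⟨u, hu, hC, hJ⟩ := APT.Problem.IsRelaxed.exists_control hp hx hx' hT
  refine ⟨u, hu, C, hC, fun v hv D hD => ?_⟩
  obtain ⟨C₂, Z₂, Y₂, Q₂, h₂, hQ₂⟩ := hK v hv D hD
  rw [← hQ₂]
  exact hJ.trans (isMinOn_iff.1 hmin (C₂, Z₂, Y₂, Q₂) h₂)
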